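/- Let $X$ and $Y$ be compact Hausdorff spaces, $X$ nonempty, and let $f:X\to Y$ be a fully closed map, i.e. a continuous map such that $f(F_1)\cap f(F_2)$ is finite for any two disjoint closed sets $F_1,F_2\subset X$. Let $C(X)$ be the space of continuous real functions on $X$ with the supremum norm, and let $c_0(Y)$ be the space of all $u:Y\to\mathbb R$ such that $\{y\in Y:|u(y)|\ge\varepsilon\}$ is finite for every $\varepsilon>0$, also with the supremum norm. The fibrewise oscillation map $$\Omega_f:C(X)\to c_0(Y),\qquad \Omega_f(g)(y)=\operatorname{diam} g(f^{-1}(y)),$$ (which is well defined; $\operatorname{diam}\emptyset=0$) is $\sigma$-slicely continuous: for every $\varepsilon>0$ one can write $C(X)=\bigcup_{n\in\mathbb N}A_n$ so that for every $n$ and every $g\in A_n$ there is an open half-space $H=\{h\in C(X):\varphi(h)>c\}$, with $0\ne\varphi\in C(X)^*$ and $c\in\mathbb R$, such that $g\in H$ and $\operatorname{diam}\Omega_f(H\cap A_n)<\varepsilon$ in the norm of $c_0(Y)$. -/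

import Mathlib

open Filter Topology Set

/-- The Banach space `c₀(Γ)` : the real families on `Γ` that tend to `0` along the cofinite filter
(for every `ε > 0` only finitely many coordinates have absolute value at least `ε`), with the
supremum norm inherited from `ℓ^∞(Γ)`. -/
def cZero (Γ : Type*) : Submodule ℝ (lp (fun _ : Γ => ℝ) ⊤) where
  carrier := {u | Tendsto (fun γ => u γ) cofinite (𝓝 0)}
  add_mem' := by
    intro u v hu hv
    simpa using Tendsto.add hu hv
  zero_mem' := by
    simpa using (tendsto_const_nhds : Tendsto (fun _ : Γ => (0 : ℝ)) cofinite (𝓝 0))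
  smul_mem' := by
    intro c u hu
    simpa using Tendsto.const_mul c hu

/-- A continuous map `f` is fully closed if `f(F₁) ∩ f(F₂)` is finite for any two
disjoint closed sets `F₁`, `F₂`. -/
structure IsFullyClosedMap {X Y : Type*} [TopologicalSpace X] [TopologicalSpace Y]
    (f : X → Y) : Prop where
  continuous : Continuous f
  finite_inter : ∀ F₁ F₂ : Set X, IsClosed F₁ → IsClosed F₂ → Disjoint F₁ F₂ →
    ((f '' F₁) ∩ (f '' F₂)).Finite

/-- Bound for the oscillation of `g` on a fibre. -/
theorem diam_image_fibre_le {X Y : Type*} [TopologicalSpace X] [CompactSpace X]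
    (f : X → Y) (g : C(X, ℝ)) (y : Y) : Metric.diam (g '' (f ⁻¹' {y})) ≤ 2 * ‖g‖ := by
  refine Metric.diam_le_of_forall_dist_le (by positivity) ?_
  rintro _ ⟨a, -, rfl⟩ _ ⟨b, -, rfl⟩
  have := g.norm_coe_le_norm a
  have := g.norm_coe_le_norm b
  rw [dist_eq_norm]
  linarith [norm_sub_le (g a) (g b)]

/-- The oscillations of `g` on the fibres of a fully closed map form an element of `c₀(Y)`. -/
theorem tendsto_diam_image_fibre {X Y : Type*} [TopologicalSpace X] [CompactSpace X]
    [TopologicalSpace Y] {f : X → Y} (hf : IsFullyClosedMap f) (g : C(X, ℝ)) :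
    Tendsto (fun y => Metric.diam (g '' (f ⁻¹' {y}))) cofinite (𝓝 0) := by
  rw [Metric.tendsto_nhds]
  intro ε hε
  rw [eventually_cofinite]
  have hδ : (0 : ℝ) < ε / 4 := by positivity
  have key : (⋃ k ∈ Set.Icc (⌊-‖g‖ / (ε / 4)⌋ : ℤ) (⌊‖g‖ / (ε / 4)⌋),
      ((f '' {x | g x ≤ ((k : ℝ) + 1) * (ε / 4)}) ∩
        (f '' {x | ((k : ℝ) + 2) * (ε / 4) ≤ g x}))).Finite := by
    refine (Set.finite_Icc _ _).biUnion fun k _ => hf.finite_inter _ _ ?_ ?_ ?_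
    · exact isClosed_le g.continuous continuous_const
    · exact isClosed_le continuous_const g.continuous
    · rw [Set.disjoint_left]
      intro x hx hx'
      simp only [Set.mem_ofPred_eq] at hx hx'
      nlinarith
  refine key.subset ?_
  intro y hy
  simp only [Set.mem_ofPred_eq, dist_zero_right, Real.norm_eq_abs, not_lt,
    abs_of_nonneg Metric.diam_nonneg] at hy
  have h2 : ∃ a ∈ f ⁻¹' {y}, ∃ b ∈ f ⁻¹' {y}, 3 * (ε / 4) < g a - g b := by
    by_contra! hcon
    have : Metric.diam (g '' (f ⁻¹' {y})) ≤ 3 * (ε / 4) := by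
      refine Metric.diam_le_of_forall_dist_le (by positivity) ?_
      rintro _ ⟨a, ha, rfl⟩ _ ⟨b, hb, rfl⟩
      rw [Real.dist_eq]
      exact abs_le.2 ⟨by linarith [hcon b hb a ha], hcon a ha b hb⟩
    linarith
  obtain ⟨a, ha, b, hb, hab⟩ := h2
  have hbn := abs_le.1 (g.norm_coe_le_norm b)
  have h3 := Int.floor_le (g b / (ε / 4))
  have h4 := Int.lt_floor_add_one (g b / (ε / 4))
  rw [le_div_iff₀ hδ] at h3
  rw [div_lt_iff₀ hδ] at h4
  refine Set.mem_biUnion (x := ⌊g b / (ε / 4)⌋) ⟨?_, ?_⟩ ⟨⟨b, h4.le, hb⟩, ⟨a, ?_, ha⟩⟩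
  · exact Int.floor_le_floor (by gcongr; exact hbn.1)
  · exact Int.floor_le_floor (by gcongr; exact hbn.2)
  · simp only [Set.mem_ofPred_eq]
    linarith

/-- The fibrewise oscillation map `Ω_f : C(X) → c₀(Y)`, `Ω_f(g)(y) = diam g(f⁻¹(y))`. -/
noncomputable def fibreOsc {X Y : Type*} [TopologicalSpace X] [CompactSpace X]
    [TopologicalSpace Y] (f : X → Y) (hf : IsFullyClosedMap f) (g : C(X, ℝ)) : cZero Y :=
  ⟨⟨fun y => Metric.diam (g '' (f ⁻¹' {y})), memℓp_infty ⟨2 * ‖g‖, by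
    rintro _ ⟨y, rfl⟩
    simpa [Real.norm_eq_abs, abs_of_nonneg Metric.diam_nonneg] using
      diam_image_fibre_le f g y⟩⟩, tendsto_diam_image_fibre hf g⟩

/-- An open half-space of a real normed space: `{x | c < φ x}` for a nonzero continuous linear
functional `φ` and a real number `c`. -/
def IsOpenHalfSpace {E : Type*} [NormedAddCommGroup E] [NormedSpace ℝ E] (H : Set E) : Prop :=
  ∃ (φ : E →L[ℝ] ℝ) (c : ℝ), φ ≠ 0 ∧ H = {x | c < φ x}

/-- A map `Φ` from a normed space to a metric space is `σ`-slicely continuous if for every `ε > 0`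
the space is a countable union of sets `A n` such that every point of `A n` lies in an open
half-space `H` for which the oscillation of `Φ` on `H ∩ A n` is less than `ε`. The oscillation
(the diameter of the image) is taken in `[0, ∞]`. -/
def IsSigmaSlicelyContinuous {E M : Type*} [NormedAddCommGroup E] [NormedSpace ℝ E]
    [MetricSpace M] (Φ : E → M) : Prop :=
  ∀ ε : ℝ, 0 < ε → ∃ A : ℕ → Set E, (⋃ n, A n) = Set.univ ∧
    ∀ n, ∀ x ∈ A n, ∃ H : Set E, IsOpenHalfSpace H ∧ x ∈ H ∧
      Metric.ediam (Φ '' (H ∩ A n)) < ENNReal.ofReal ε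

/-! Each coordinate of `Ω_f` is a maximum of functionals `h ↦ h a - h b` over a compact fibre, so it
is supported at `g` by one of them. Fix a grid of thresholds and consider the total excess of the
coordinates over it, a finite sum because `Ω_f g` lies in `c₀(Y)`. The set of exceeded thresholds is
the one that maximises the corresponding sum. If all coordinates stay `2δ` away from the grid, it is
the only maximiser, and every other finite set falls short by at least `2δ`. Fix the excess up to
`δ` on each piece. The half-space given by the sum of the functionals supporting at `g` then forces
`h` to exceed exactly the thresholds that `g` exceeds (`exists_isOpenHalfSpace_dist_le`), so the
coordinates agree up to the mesh. Countably many parameters suffice. -/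

/-- If `G` consists of the indices at which `w` is positive, `|w|` is at least `η`, and the sum of
`w` over `F` is within less than `η` of the sum over `G`, then `F = G`. -/
theorem Finset.eq_of_sum_sub_sum_lt {I : Type*} {F G : Finset I} {w : I → ℝ} {η : ℝ}
    (hG : ∀ i, i ∈ G ↔ 0 < w i) (hη : ∀ i, η ≤ |w i|)
    (hlt : ∑ i ∈ G, w i - ∑ i ∈ F, w i < η) : F = G := by
  classical
  have hout : ∀ i ∈ F \ G, w i ≤ 0 := fun i hi =>
    not_lt.1 fun h => (Finset.mem_sdiff.1 hi).2 ((hG i).2 h)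
  have hin : ∀ i ∈ G \ F, 0 ≤ w i := fun i hi => ((hG i).1 (Finset.mem_sdiff.1 hi).1).le
  rw [← Finset.sum_sdiff_sub_sum_sdiff] at hlt
  have h1 := Finset.sum_nonneg hin
  have h2 := Finset.sum_nonpos hout
  refine Finset.Subset.antisymm (fun i hi => ?_) fun i hi => ?_ <;> by_contra hni
  · have hmem : i ∈ F \ G := Finset.mem_sdiff.2 ⟨hi, hni⟩
    have h3 := Finset.single_le_sum (f := fun i => -w i) (fun j hj => neg_nonneg.2 (hout j hj)) hmem
    rw [Finset.sum_neg_distrib] at h3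
    have := hη i
    rw [abs_of_nonpos (hout i hmem)] at this
    linarith
  · have hmem : i ∈ G \ F := Finset.mem_sdiff.2 ⟨hi, hni⟩
    have h3 := Finset.single_le_sum hin hmem
    have := hη i
    rw [abs_of_nonneg (hin i hmem)] at this
    linarith

/-- Two numbers in `[0, m e]` which lie on the same side of each of the thresholds
`t, t + e, …, t + (m - 1) e`, where `0 ≤ t ≤ e`, differ by at most `e`. -/
theorem sub_le_of_threshold_iff {e t a b : ℝ} {m : ℕ} (ht0 : 0 ≤ t) (hte : t ≤ e)
    (ha0 : 0 ≤ a) (hb : b ≤ m * e) (h : ∀ j : Fin m, t + j * e < b → t + j * e < a) :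
    b - a ≤ e := by
  by_contra! hlt
  have he : 0 ≤ e := ht0.trans hte
  -- Since `b > a + e`, passing one threshold with `a` makes `b` pass the next, hence `a` too; past
  -- the last one, `b > m * e`.
  have key : ∀ j : ℕ, j < m → t + j * e < a := by
    intro j
    induction j with
    | zero =>
      intro hj
      simpa using h ⟨0, hj⟩ (by simpa using by linarith)
    | succ j ih =>
      intro hj
      have := ih (by omega)
      refine h ⟨j + 1, hj⟩ ?_
      push_cast
      linarith
  rcases m with _ | m
  · simp at hb
    linarith
  · have := key m (by omega)
    push_cast at hb
    linarith

/-- The elements of `c₀(Γ)` have only finitely many coordinates above a positive number. -/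
theorem cZero.finite_lt {Γ : Type*} (u : cZero Γ) {r : ℝ} (hr : 0 < r) :
    {γ | r < (u : lp (fun _ : Γ => ℝ) ⊤) γ}.Finite := by
  have h : Tendsto (fun γ => (u : lp (fun _ : Γ => ℝ) ⊤) γ) cofinite (𝓝 0) := u.2
  have := h.eventually (gt_mem_nhds hr)
  rw [eventually_cofinite] at this
  exact this.subset fun γ hγ => not_lt.2 (le_of_lt hγ)

theorem cZero.finite_threshold_lt {Γ : Type*} (u : cZero Γ) {e t : ℝ} (he : 0 ≤ e) (ht : 0 < t)
    (m : ℕ) :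
    {i : Γ × Fin m | t + i.2 * e < (u : lp (fun _ : Γ => ℝ) ⊤) i.1}.Finite := by
  refine ((cZero.finite_lt u ht).prod (Set.finite_univ (α := Fin m))).subset fun i hi => ⟨?_, Set.mem_univ _⟩
  rw [Set.mem_ofPred_eq] at hi ⊢
  have : (0 : ℝ) ≤ i.2 * e := by positivity
  linarith

/-- The elements of `c₀(Γ)` admit an arithmetic progression of thresholds with rational first term
which stays away from all coordinates. -/
theorem cZero.exists_threshold {Γ : Type*} (u : cZero Γ) {e : ℝ} (he : 0 < e) (m : ℕ) :
    ∃ (t : ℚ) (k : ℕ), 0 < (t : ℝ) ∧ (t : ℝ) < e ∧ ∀ (γ : Γ) (j : Fin m),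
      2 * (1 / ((k : ℝ) + 1)) ≤ |(u : lp (fun _ : Γ => ℝ) ⊤) γ - (t + j * e)| := by
  -- With `t` in `(e/2, e)`, coordinates at most `e/4` are more than `e/4` below every threshold;
  -- the finitely many others exclude only finitely many `t`.
  have hfin := (cZero.finite_lt u (r := e / 4) (by positivity)).prod (Set.finite_univ (α := Fin m))
  set B : Set (Γ × Fin m) := {γ | e / 4 < (u : lp (fun _ : Γ => ℝ) ⊤) γ} ×ˢ Set.univ
  have hbad := hfin.image fun i => (u : lp (fun _ : Γ => ℝ) ⊤) i.1 - i.2 * e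
  obtain ⟨t, ⟨ht1, ht2⟩, htB⟩ := (Rat.denseRange_cast (𝕜 := ℝ)).exists_mem_open
    (isOpen_Ioo.sdiff hbad.isClosed)
    ((Set.Ioo_infinite (show e / 2 < e by linarith)).sdiff hbad).nonempty
  have hlim : Tendsto (fun k : ℕ => 2 * (1 / ((k : ℝ) + 1))) atTop (𝓝 0) := by
    simpa using (tendsto_one_div_add_atTop_nhds_zero_nat (𝕜 := ℝ)).const_mul 2
  have hB : ∀ᶠ k : ℕ in atTop, ∀ i ∈ B, 2 * (1 / ((k : ℝ) + 1)) <
      |(u : lp (fun _ : Γ => ℝ) ⊤) i.1 - (t + i.2 * e)| := by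
    refine hfin.eventually_all.2 fun i hi => hlim.eventually (gt_mem_nhds ?_)
    refine abs_pos.2 fun h0 => htB ⟨i, hi, ?_⟩
    dsimp only
    linarith
  obtain ⟨k, hkB, hk⟩ :=
    (hB.and (hlim.eventually (gt_mem_nhds (show 0 < e / 4 by positivity)))).exists
  refine ⟨t, k, by linarith, ht2, fun γ j => ?_⟩
  by_cases hγ : (γ, j) ∈ B
  · exact (hkB _ hγ).le
  · have hγ' : (u : lp (fun _ : Γ => ℝ) ⊤) γ ≤ e / 4 := not_lt.1 fun h => hγ ⟨h, Set.mem_univ _⟩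
    have : (0 : ℝ) ≤ j * e := by positivity
    rw [abs_sub_comm]
    exact le_trans (by linarith) (le_abs_self _)

/-- A half-space `{c < ψ}` around `x` with possibly vanishing `ψ` contains a proper one. -/
theorem exists_isOpenHalfSpace_subset {E : Type*} [NormedAddCommGroup E] [NormedSpace ℝ E]
    [Nontrivial E] (ψ : E →L[ℝ] ℝ) {c : ℝ} {x : E} (hx : c < ψ x) :
    ∃ H : Set E, IsOpenHalfSpace H ∧ x ∈ H ∧ ∀ h ∈ H, c < ψ h := by
  by_cases hψ : ψ = 0
  -- This occurs, for instance, for an empty sum of functionals. Then `c < 0`, and any half-space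
  -- around `x` will do.
  · obtain ⟨z, hz⟩ := exists_ne (0 : E)
    obtain ⟨χ, -, hχ⟩ := exists_dual_vector ℝ z (norm_ne_zero_iff.2 hz)
    have hχ0 : χ ≠ 0 := by
      rintro rfl
      exact hz (norm_eq_zero.1 (by simpa using hχ.symm))
    refine ⟨{h | χ x - 1 < χ h}, ⟨χ, _, hχ0, rfl⟩, by simp, fun h _ => ?_⟩
    simpa [hψ] using hx
  · exact ⟨{h | c < ψ h}, ⟨ψ, c, hψ, rfl⟩, hx, fun _ h => h⟩

/-- The total excess of the coordinates of `u` over the thresholds `t, t + e, …, t + (m - 1) e`. -/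
noncomputable def cZero.excess {Γ : Type*} (u : cZero Γ) (e t : ℝ) (m : ℕ) : ℝ :=
  ∑ᶠ i ∈ {i : Γ × Fin m | t + i.2 * e < (u : lp (fun _ : Γ => ℝ) ⊤) i.1},
    ((u : lp (fun _ : Γ => ℝ) ⊤) i.1 - (t + i.2 * e))

theorem cZero.excess_nonneg {Γ : Type*} (u : cZero Γ) (e t : ℝ) (m : ℕ) : 0 ≤ cZero.excess u e t m :=
  finsum_mem_induction (0 ≤ ·) le_rfl (fun _ _ => add_nonneg) fun _ hi => sub_nonneg.2 (le_of_lt hi)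

/-- The elements of `c₀(Γ)` with coordinates at most `m e` and at distance at least `2 δ` from the
thresholds, whose total excess over the thresholds lies in `[l δ, (l + 1) δ)`. -/
def cZero.thresholdClass (Γ : Type*) (e t δ : ℝ) (m l : ℕ) : Set (cZero Γ) :=
  {u | (∀ γ, (u : lp (fun _ : Γ => ℝ) ⊤) γ ≤ m * e) ∧
    (∀ γ, ∀ j : Fin m, 2 * δ ≤ |(u : lp (fun _ : Γ => ℝ) ⊤) γ - (t + j * e)|) ∧
    l * δ ≤ cZero.excess u e t m ∧ cZero.excess u e t m < (l + 1) * δ}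

theorem cZero.exists_mem_thresholdClass {Γ : Type*} (u : cZero Γ) {e : ℝ} (he : 0 < e) :
    ∃ (t : ℚ) (m k l : ℕ), 0 < (t : ℝ) ∧ (t : ℝ) < e ∧
      u ∈ cZero.thresholdClass Γ e t (1 / ((k : ℝ) + 1)) m l := by
  obtain ⟨m, hm⟩ := exists_nat_ge (‖(u : lp (fun _ : Γ => ℝ) ⊤)‖ / e)
  obtain ⟨t, k, ht0, hte, htk⟩ := cZero.exists_threshold u he m
  have hk : (0 : ℝ) < 1 / ((k : ℝ) + 1) := by positivity
  refine ⟨t, m, k, ⌊cZero.excess u e t m / (1 / ((k : ℝ) + 1))⌋₊, ht0, hte, fun γ => ?_, htk, ?_, ?_⟩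
  · rw [div_le_iff₀ he] at hm
    exact ((le_abs_self _).trans
      (lp.norm_apply_le_norm (by simp) (u : lp (fun _ : Γ => ℝ) ⊤) γ)).trans hm
  · rw [← le_div_iff₀ hk]
    exact Nat.floor_le (div_nonneg (cZero.excess_nonneg u _ _ _) hk.le)
  · rw [← div_lt_iff₀ hk]
    exact Nat.lt_floor_add_one _

/-- Each point of the preimage of a threshold class lies in a half-space on which the map is
constant up to `e`, provided the coordinates are supported by continuous linear functionals. -/
theorem exists_isOpenHalfSpace_dist_le {E Γ : Type*} [NormedAddCommGroup E] [NormedSpace ℝ E]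
    [Nontrivial E] {Φ : E → cZero Γ}
    (hpos : ∀ x γ, 0 ≤ (Φ x : lp (fun _ : Γ => ℝ) ⊤) γ)
    (hsupp : ∀ x γ, ∃ ψ : E →L[ℝ] ℝ, ψ x = (Φ x : lp (fun _ : Γ => ℝ) ⊤) γ ∧
      ∀ h, ψ h ≤ (Φ h : lp (fun _ : Γ => ℝ) ⊤) γ)
    {e t δ : ℝ} {m l : ℕ} (ht0 : 0 < t) (hte : t < e) (hδ : 0 < δ) {x : E}
    (hx : Φ x ∈ cZero.thresholdClass Γ e t δ m l) :
    ∃ H : Set E, IsOpenHalfSpace H ∧ x ∈ H ∧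
      ∀ h ∈ H, Φ h ∈ cZero.thresholdClass Γ e t δ m l →
        ∀ γ, |(Φ h : lp (fun _ : Γ => ℝ) ⊤) γ - (Φ x : lp (fun _ : Γ => ℝ) ⊤) γ| ≤ e := by
  have hfin := fun y => cZero.finite_threshold_lt (Φ y) (ht0.trans hte).le ht0 m
  choose ψ hψx hψ using hsupp x
  have hexc : ∀ y, cZero.excess (Φ y) e t m = ∑ i ∈ (hfin y).toFinset,
      ((Φ y : lp (fun _ : Γ => ℝ) ⊤) i.1 - (t + i.2 * e)) := fun y =>
    finsum_mem_eq_finite_toFinset_sum _ (hfin y)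
  set F := (hfin x).toFinset with hF
  obtain ⟨hxm, -, hxl, -⟩ := id hx
  -- At `x` the sum minus the thresholds is the excess, at least `l * δ`; the slack `δ` makes the
  -- inequality strict.
  obtain ⟨H, hH, hxH, hHψ⟩ := exists_isOpenHalfSpace_subset (∑ i ∈ F, ψ i.1)
    (c := l * δ - δ + ∑ i ∈ F, (t + i.2 * e)) (x := x) (by
      rw [hexc, Finset.sum_sub_distrib] at hxl
      simp only [_root_.sum_apply, hψx]
      linarith)
  refine ⟨H, hH, hxH, fun h hh hcl => ?_⟩
  obtain ⟨hhm, hhδ, -, hhl⟩ := hcl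
  -- The sum over `F` exceeds `(l - 1) * δ` and the excess of `h` is below `(l + 1) * δ`: a gap
  -- under `2 * δ`.
  have hFG : F = (hfin h).toFinset := by
    refine Finset.eq_of_sum_sub_sum_lt (η := 2 * δ)
      (w := fun i => (Φ h : lp (fun _ : Γ => ℝ) ⊤) i.1 - (t + i.2 * e))
      (fun i => by simp) (fun i => hhδ i.1 i.2) ?_
    have h1 := hHψ h hh
    rw [_root_.sum_apply] at h1
    have h2 := Finset.sum_le_sum (s := F) fun i _ => hψ i.1 h
    rw [← hexc, Finset.sum_sub_distrib]
    linarith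
  have hiff : ∀ γ (j : Fin m), t + j * e < (Φ x : lp (fun _ : Γ => ℝ) ⊤) γ ↔
      t + j * e < (Φ h : lp (fun _ : Γ => ℝ) ⊤) γ := fun γ j => by
    simpa [hF] using Finset.ext_iff.1 hFG (γ, j)
  refine fun γ => abs_sub_le_iff.2 ⟨?_, ?_⟩
  · exact sub_le_of_threshold_iff ht0.le hte.le (hpos _ _) (hhm γ) fun j => (hiff γ j).2
  · exact sub_le_of_threshold_iff ht0.le hte.le (hpos _ _) (hxm γ) fun j => (hiff γ j).1

/-- A map into `c₀(Γ)` with nonnegative coordinates which are supported at each point by continuous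
linear functionals is `σ`-slicely continuous. -/
theorem isSigmaSlicelyContinuous_of_supported {E Γ : Type*} [NormedAddCommGroup E]
    [NormedSpace ℝ E] [Nontrivial E] {Φ : E → cZero Γ}
    (hpos : ∀ x γ, 0 ≤ (Φ x : lp (fun _ : Γ => ℝ) ⊤) γ)
    (hsupp : ∀ x γ, ∃ ψ : E →L[ℝ] ℝ, ψ x = (Φ x : lp (fun _ : Γ => ℝ) ⊤) γ ∧
      ∀ h, ψ h ≤ (Φ h : lp (fun _ : Γ => ℝ) ⊤) γ) :
    IsSigmaSlicelyContinuous Φ := by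
  intro ε hε
  -- Comparing two points through `Φ x` doubles the mesh to `ε / 2`, leaving room for the strict
  -- inequality.
  have he : 0 < ε / 4 := by positivity
  obtain ⟨p, hp⟩ := exists_surjective_nat (ℚ × ℕ × ℕ × ℕ)
  refine ⟨fun n => {x | 0 < ((p n).1 : ℝ) ∧ ((p n).1 : ℝ) < ε / 4 ∧ Φ x ∈ cZero.thresholdClass Γ
    (ε / 4) (p n).1 (1 / (((p n).2.2.1 : ℝ) + 1)) (p n).2.1 (p n).2.2.2}, ?_, ?_⟩
  · refine Set.eq_univ_of_forall fun x => ?_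
    obtain ⟨t, m, k, l, ht⟩ := cZero.exists_mem_thresholdClass (Φ x) he
    obtain ⟨n, hn⟩ := hp (t, m, k, l)
    refine Set.mem_iUnion.2 ⟨n, ?_⟩
    simpa only [Set.mem_ofPred_eq, hn] using ht
  · rintro n x ⟨ht0, hte, hx⟩
    obtain ⟨H, hH, hxH, hclose⟩ :=
      exists_isOpenHalfSpace_dist_le hpos hsupp ht0 hte (by positivity) hx
    refine ⟨H, hH, hxH, lt_of_le_of_lt (b := ENNReal.ofReal (2 * (ε / 4))) ?_
      ((ENNReal.ofReal_lt_ofReal_iff hε).2 (by linarith))⟩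
    have hdist : ∀ h ∈ H, Φ h ∈ cZero.thresholdClass Γ
        (ε / 4) (p n).1 (1 / (((p n).2.2.1 : ℝ) + 1)) (p n).2.1 (p n).2.2.2 →
        dist (Φ h) (Φ x) ≤ ε / 4 := fun h hh hcl => by
      rw [Subtype.dist_eq, dist_eq_norm]
      exact lp.norm_le_of_forall_le he.le fun γ => hclose h hh hcl γ
    refine Metric.ediam_le ?_
    rintro _ ⟨a, ⟨haH, -, -, ha⟩, rfl⟩ _ ⟨b, ⟨hbH, -, -, hb⟩, rfl⟩
    rw [edist_dist]
    refine ENNReal.ofReal_le_ofReal ((dist_triangle_right _ _ (Φ x)).trans ?_)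
    linarith [hdist a haH ha, hdist b hbH hb]

/-- The oscillation of continuous functions on a compact set is supported at each point by a
continuous linear functional. -/
theorem exists_clm_eq_diam_image {X : Type*} [TopologicalSpace X] [CompactSpace X] {K : Set X}
    (hK : IsCompact K) (g : C(X, ℝ)) :
    ∃ ψ : C(X, ℝ) →L[ℝ] ℝ, ψ g = Metric.diam (g '' K) ∧ ∀ h, ψ h ≤ Metric.diam (h '' K) := by
  rcases K.eq_empty_or_nonempty with rfl | hne
  · exact ⟨0, by simp, by simp⟩
  obtain ⟨⟨a, b⟩, ⟨ha, hb⟩, hmax⟩ := (hK.prod hK).exists_isMaxOn (hne.prod hne)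
    (f := fun q : X × X => g q.1 - g q.2) (by fun_prop)
  have hle : ∀ h : C(X, ℝ), h a - h b ≤ Metric.diam (h '' K) := fun h =>
    (le_abs_self _).trans (Metric.dist_le_diam_of_mem (hK.image h.continuous).isBounded
      (Set.mem_image_of_mem h ha) (Set.mem_image_of_mem h hb))
  refine ⟨ContinuousMap.evalCLM ℝ a - ContinuousMap.evalCLM ℝ b, le_antisymm (hle g) ?_, hle⟩
  have hmax' : ∀ c ∈ K, ∀ d ∈ K, g c - g d ≤ g a - g b := fun c hc d hd =>
    hmax (Set.mk_mem_prod hc hd)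
  refine Metric.diam_le_of_forall_dist_le (by simpa using hmax' a ha a ha) ?_
  rintro _ ⟨c, hc, rfl⟩ _ ⟨d, hd, rfl⟩
  exact abs_sub_le_iff.2 ⟨hmax' c hc d hd, hmax' d hd c hc⟩

theorem mainTheorem4 {X Y : Type*} [TopologicalSpace X] [CompactSpace X] [T2Space X] [Nonempty X]
    [TopologicalSpace Y] [CompactSpace Y] [T2Space Y]
    (f : X → Y) (hf : IsFullyClosedMap f) :
    IsSigmaSlicelyContinuous (fibreOsc f hf) :=
  isSigmaSlicelyContinuous_of_supported (fun _ _ => Metric.diam_nonneg) fun g _ =>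
    exists_clm_eq_diam_image (isClosed_singleton.preimage hf.continuous).isCompact g
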